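/- Let $G=(V,E)$ be a finite graph without loops and parallel edges, with $|E|=n$ edges, numbered $e_1,\dots,e_n$. The matching polyhedron $P(G)\subseteq\mathbb R^n$ is the set of all $x=(x_1,\dots,x_n)$ such that $x_i\ge 0$ for all $i$; $\sum_{i:\,v\in e_i}x_i\le 1$ for every $v\in V$; and $\sum_{i:\,e_i\subseteq S}x_i\le k$ for every $S\subseteq V$ with $|S|=2k+1$, $k\ge 0$. A simple path or simple cycle is given by the sequence of its edges $(e_{i_1},\dots,e_{i_k})$, $k\ge 1$: the edges are pairwise distinct, consecutive edges have a common vertex, and no two other edges, except possibly the first and the last one, have a common vertex. The sequence is a cycle if $k\ge 2$ and $e_{i_1},e_{i_k}$ have a common vertex, and a path otherwise. The matching arrangement $MA(G)$ is the set of all hyperplanes $$\{x\in\mathbb R^n : x_{i_1}-x_{i_2}+x_{i_3}-\dots+(-1)^{k+1}x_{i_k}=0\},$$ one for each edge sequence $(e_{i_1},\dots,e_{i_k})$ that forms a simple path or a simple cycle with an even number $k$ of edges. A region of $MA(G)$ is a connected component of the complement in $\mathbb R^n$ of the union of these hyperplanes. The graph of $P(G)$ has as its vertices the vertices (extreme points)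 of $P(G)$; two different vertices are adjacent if the segment between them is a face of $P(G)$. A linear function $\varphi:\mathbb R^n\to\mathbb R$ that takes different values on any two adjacent vertices induces the orientation of this graph in which the edge between adjacent vertices $u,v$ is oriented from $u$ to $v$ if $\varphi(u)<\varphi(v)$. An orientation induced by some such linear function is called an LP-orientation of $P(G)$. For an LP-orientation $O$ let $$F(O)=\{(\alpha_1,\dots,\alpha_n)\in\mathbb R^n : x\mapsto\alpha_1x_1+\dots+\alpha_nx_n \text{ induces } O\}.$$ **Theorem.** 1. For every LP-orientation $O$ of $P(G)$, the set $F(O)$ is a region of $MA(G)$. 2. The map $O\mapsto F(O)$ is a bijection from the set of LP-orientations of $P(G)$ onto the set of regions of $MA(G)$. -/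

import Mathlib

namespace MatchingArrangement

/-! ### Sequences of edges, simple paths, simple cycles -/

/-- Two edges are incident to a common vertex. -/
def ShareVertex {V : Type*} {G : SimpleGraph V} (e f : G.edgeSet) : Prop :=
  ∃ v : V, v ∈ (e : Sym2 V) ∧ v ∈ (f : Sym2 V)

/-- A nonempty sequence of pairwise distinct edges in which consecutive edges are incident to a
common vertex. -/
structure IsEdgeChain {V : Type*} {G : SimpleGraph V} {k : ℕ} (r : Fin k → G.edgeSet) : Prop where
  pos : 0 < k
  injective : Function.Injective r
  consecutive : ∀ i j : Fin k, (j : ℕ) = i + 1 → ShareVertex (r i) (r j)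

/-- The chain closes up: it has at least two edges, and its first and its last edge are incident
to a common vertex. -/
def IsClosedChain {V : Type*} {G : SimpleGraph V} {k : ℕ} (r : Fin k → G.edgeSet) : Prop :=
  2 ≤ k ∧ ∀ i j : Fin k, (i : ℕ) = 0 → (j : ℕ) + 1 = k → ShareVertex (r i) (r j)

/-- The only pairs of edges that may be incident to a common vertex are the consecutive ones and
the pair formed by the first and the last edge. -/
def IsSimpleChain {V : Type*} {G : SimpleGraph V} {k : ℕ} (r : Fin k → G.edgeSet) : Prop :=
  ∀ i j : Fin k, i < j → ShareVertex (r i) (r j) →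
    (j : ℕ) = i + 1 ∨ ((i : ℕ) = 0 ∧ (j : ℕ) + 1 = k)

/-- A simple path, as the sequence of its edges. -/
def IsSimplePath {V : Type*} {G : SimpleGraph V} {k : ℕ} (r : Fin k → G.edgeSet) : Prop :=
  IsEdgeChain r ∧ ¬ IsClosedChain r ∧ IsSimpleChain r

/-- A simple cycle, as the sequence of its edges. (Two distinct edges at a common vertex fall
under this definition and not under `IsSimplePath`; their number is even, so that they contribute
the same hyperplane as a path of length two. Three edges at a common vertex fall under it as well,
but their number is odd.) -/
def IsSimpleCycle {V : Type*} {G : SimpleGraph V} {k : ℕ} (r : Fin k → G.edgeSet) : Prop :=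
  IsEdgeChain r ∧ IsClosedChain r ∧ IsSimpleChain r

/-! ### The matching arrangement and its regions -/

/-- The hyperplane `x_{r 1} - x_{r 2} + x_{r 3} - … = 0` in `ℝⁿ`, where the edges of the graph are
numbered by `N`. -/
def alternatingHyperplane {V : Type*} {G : SimpleGraph V} {n : ℕ} (N : G.edgeSet ≃ Fin n) {k : ℕ}
    (r : Fin k → G.edgeSet) : Set (Fin n → ℝ) :=
  {x | ∑ i : Fin k, (-1 : ℝ) ^ (i : ℕ) * x (N (r i)) = 0}

/-- The matching arrangement `MA(G, N)`: the set of the hyperplanes of all simple paths and all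
simple cycles with an even number of edges. -/
def matchingArrangement {V : Type*} (G : SimpleGraph V) {n : ℕ} (N : G.edgeSet ≃ Fin n) :
    Set (Set (Fin n → ℝ)) :=
  {H | ∃ (k : ℕ) (r : Fin k → G.edgeSet),
    (IsSimplePath r ∨ (IsSimpleCycle r ∧ Even k)) ∧ H = alternatingHyperplane N r}

/-- The regions of an arrangement: the connected components of the complement of the union of its
hyperplanes. -/
def regions {n : ℕ} (A : Set (Set (Fin n → ℝ))) : Set (Set (Fin n → ℝ)) :=
  {R | ∃ x ∈ (⋃₀ A)ᶜ, R = connectedComponentIn (⋃₀ A)ᶜ x}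

/-! ### The matching polyhedron -/

open Classical in
/-- The matching polyhedron, defined by Edmonds' inequalities. -/
noncomputable def matchingPolyhedron {V : Type*} (G : SimpleGraph V) {n : ℕ}
    (N : G.edgeSet ≃ Fin n) : Set (Fin n → ℝ) :=
  {x | (∀ i : Fin n, 0 ≤ x i) ∧
    (∀ v : V, ∑ i : Fin n with v ∈ (N.symm i : Sym2 V), x i ≤ 1) ∧
    (∀ (k : ℕ) (S : Finset V), S.card = 2 * k + 1 →
      ∑ i : Fin n with (∀ v ∈ (N.symm i : Sym2 V), v ∈ S), x i ≤ (k : ℝ))}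

/-! ### The graph of a polyhedron and its LP-orientations -/

/-- The graph of a polyhedron `P`: its vertices are the extreme points of `P`, and two different
vertices are adjacent if the segment between them is a face of `P`, that is, the set of maximum
points on `P` of some linear function. -/
def polyhedronGraph {n : ℕ} (P : Set (Fin n → ℝ)) : SimpleGraph (P.extremePoints ℝ) where
  Adj u v := u ≠ v ∧ IsExposed ℝ P (segment ℝ (u : Fin n → ℝ) (v : Fin n → ℝ))
  symm := ⟨fun u v h => ⟨h.1.symm, by
    have h2 := h.2
    rwa [segment_symm] at h2⟩⟩
  loopless := ⟨fun _ h => h.1 rfl⟩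

/-- An orientation of a graph: every edge receives exactly one of its two directions. -/
@[ext]
structure GraphOrientation {W : Type*} (H : SimpleGraph W) where
  /-- `dir u v`: the edge between `u` and `v` is oriented from `u` to `v`. -/
  dir : W → W → Prop
  adj_of_dir : ∀ u v, dir u v → H.Adj u v
  xor_dir : ∀ u v, H.Adj u v → Xor (dir u v) (dir v u)

/-- The linear function `φ` induces the orientation `O` of the graph of `P`: it takes different
values on adjacent vertices, and every edge is oriented towards the larger value. -/
def Induces {n : ℕ} {P : Set (Fin n → ℝ)} (φ : (Fin n → ℝ) →ₗ[ℝ] ℝ)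
    (O : GraphOrientation (polyhedronGraph P)) : Prop :=
  (∀ u v, (polyhedronGraph P).Adj u v → φ u ≠ φ v) ∧
    ∀ u v, (polyhedronGraph P).Adj u v → (O.dir u v ↔ φ u < φ v)

/-- The set of LP-orientations of `P`. -/
def lpOrientations {n : ℕ} (P : Set (Fin n → ℝ)) : Set (GraphOrientation (polyhedronGraph P)) :=
  {O | ∃ φ : (Fin n → ℝ) →ₗ[ℝ] ℝ, Induces φ O}

/-- The linear function `x ↦ α₁ x₁ + … + αₙ xₙ`. -/
def linearFunction {n : ℕ} (α : Fin n → ℝ) : (Fin n → ℝ) →ₗ[ℝ] ℝ :=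
  ∑ i : Fin n, α i • LinearMap.proj i

/-- `F(O)`: the set of the coefficient vectors whose linear functions induce `O`. -/
def inducingVectors {n : ℕ} {P : Set (Fin n → ℝ)} (O : GraphOrientation (polyhedronGraph P)) :
    Set (Fin n → ℝ) :=
  {α | Induces (linearFunction α) O}

end MatchingArrangement

/-!
The theorem rests on the following description of the edges of the matching polyhedron `P(G)`: the
differences `u - v` of adjacent vertices are, up to nonzero factors, exactly the normal vectors of
the hyperplanes of `MA(G)`. Hence a linear function takes different values on any two adjacent
vertices if and only if its coefficient vector lies on no hyperplane
(`mem_compl_matchingArrangement_iff`). The rest is topology: `F(O)` is cut out by strict linear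
inequalities, so it is convex and lies in one region, and it is all of that region because, by the
intermediate value theorem, the order of two adjacent vertices is constant on a region
(`inducingVectors_eq_connectedComponentIn`).

Every hyperplane comes from an edge (`IsAlternatingChain.exists_adjacent`): the odd and the even
members of a simple path or an even simple cycle are two matchings, and the inequalities
`x_i + x_j ≤ 1` for consecutive members `i`, `j`, together with `0 ≤ x_i` for the other edges `i`,
are tight on `P(G)` exactly on the segment between their characteristic vectors.

Conversely (`exists_isAlternatingChain`), let the segment between two vertices be a face. By
Edmonds' theorem the vertices are characteristic vectors of matchings `M`, `N`. Exchanging `M` and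
`N` along a connected component of `M ∆ N` gives two matchings with the same midpoint, which must
therefore lie on the segment; so `M ∆ N` has a single component. It is a path or an even cycle,
and a longest path of edges in it runs through all of it.

Edmonds' theorem (`exists_chi_of_mem_extremePoints`) is proved in the form that for every weight
`w` a matching of maximum weight is optimal over the whole polytope (`IsOptimal.sum_mul_le`), from
which the Hahn-Banach theorem gives that the polytope is the convex hull of the matchings.
If `w ≠ 0`, one of the defining inequalities is tight on all matchings of maximum weight
(`exists_tight`): otherwise every edge lies in such a matching and every vertex is left free by
one, and Gallai's lemma, here the transitivity statement `not_both_free_trans`, shows that a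
component of the edges of positive weight has `2 * k + 1` vertices and contains `k` edges of every
matching of maximum weight. A multiple of the tight inequality is then subtracted from `w` so that
one more matching becomes optimal.

The combinatorial part is carried out for loopless multigraphs, given by the map `e : E → Sym2 V`
from the edges to their pairs of ends.
-/

namespace MatchingArrangement

section Multigraph

open scoped Classical

variable {V E : Type*} {e : E → Sym2 V}

/-! ### Matchings, and exchanging along closed sets of edges -/

/-- The edges `i` and `j` of the multigraph with end point map `e` have a common vertex. Every
edge meets itself. -/
def Meet (e : E → Sym2 V) (i j : E) : Prop := ∃ v, v ∈ e i ∧ v ∈ e j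

theorem Meet.symm {i j : E} (h : Meet e i j) : Meet e j i :=
  let ⟨v, hi, hj⟩ := h; ⟨v, hj, hi⟩

/-- A set of edges no two of which have a common vertex. -/
def IsMatching (e : E → Sym2 V) (M : Finset E) : Prop :=
  ∀ i ∈ M, ∀ j ∈ M, Meet e i j → i = j

theorem IsMatching.mono {M N : Finset E} (hN : IsMatching e N) (h : M ⊆ N) : IsMatching e M :=
  fun i hi j hj => hN i (h hi) j (h hj)

theorem isMatching_empty : IsMatching e (∅ : Finset E) := by
  intro i hi; simp at hi

/-- `M` with its part inside `C` replaced by the part of `N` inside `C`. -/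
noncomputable def exchange (M N C : Finset E) : Finset E := M \ C ∪ N ∩ C

theorem mem_exchange {M N C : Finset E} {i : E} :
    i ∈ exchange M N C ↔ (i ∈ M ∧ i ∉ C) ∨ (i ∈ N ∧ i ∈ C) := by
  simp [exchange]

/-- `C` is a union of connected components of the set `D` of edges. -/
def IsClosedIn (e : E → Sym2 V) (D C : Finset E) : Prop :=
  C ⊆ D ∧ ∀ i ∈ C, ∀ j ∈ D, Meet e i j → j ∈ C

theorem IsMatching.exchange {M N C : Finset E} (hM : IsMatching e M) (hN : IsMatching e N)
    (hC : IsClosedIn e (symmDiff M N) C) : IsMatching e (exchange M N C) := by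
  have key : ∀ i ∈ M, i ∉ C → ∀ j ∈ N, j ∈ C → ¬ Meet e i j := by
    intro i hi hiC j hj hjC hij
    by_cases hiN : i ∈ N
    · exact hiC (hN i hiN j hj hij ▸ hjC)
    · exact hiC (hC.2 j hjC i (by simp [Finset.mem_symmDiff, hi, hiN]) hij.symm)
  intro i hi j hj hij
  rw [mem_exchange] at hi hj
  rcases hi with ⟨hi, hiC⟩ | ⟨hi, hiC⟩ <;> rcases hj with ⟨hj, hjC⟩ | ⟨hj, hjC⟩
  · exact hM i hi j hj hij
  · exact (key i hi hiC j hj hjC hij).elim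
  · exact (key j hj hjC i hi hiC hij.symm).elim
  · exact hN i hi j hj hij

/-! ### Paths in the symmetric difference of two matchings -/

/-- Two distinct edges of `M ∆ N` with a common vertex lie in different matchings. -/
theorem mem_right_of_meet {M N : Finset E} (hM : IsMatching e M) {i j : E} (hi : i ∈ M)
    (hj : j ∈ symmDiff M N) (hij : Meet e i j) (hne : i ≠ j) : j ∈ N ∧ j ∉ M := by
  have hjM : j ∉ M := fun h => hne (hM i hi j h hij)
  rw [Finset.mem_symmDiff] at hj
  tauto

theorem mem_left_iff_of_meet {M N : Finset E} (hM : IsMatching e M) (hN : IsMatching e N) {i j : E}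
    (hi : i ∈ symmDiff M N) (hj : j ∈ symmDiff M N) (hij : Meet e i j) (hne : i ≠ j) :
    i ∈ M ↔ j ∉ M := by
  refine ⟨fun h => (mem_right_of_meet hM h hj hij hne).2, fun h => ?_⟩
  have hjN : j ∈ N := by
    rw [Finset.mem_symmDiff] at hj; tauto
  exact (mem_right_of_meet hN hjN (symmDiff_comm M N ▸ hi) hij.symm hne.symm).1

theorem not_three_meet_aux {M N : Finset E} (hM : IsMatching e M) (hN : IsMatching e N)
    {i a b c : E} (hi : i ∈ M) (ha : a ∈ symmDiff M N) (hb : b ∈ symmDiff M N)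
    (hc : c ∈ symmDiff M N) (hia : Meet e i a) (hib : Meet e i b) (hic : Meet e i c)
    (ha' : i ≠ a) (hb' : i ≠ b) (hc' : i ≠ c) : a = b ∨ a = c ∨ b = c := by
  have haN := (mem_right_of_meet hM hi ha hia ha').1
  have hbN := (mem_right_of_meet hM hi hb hib hb').1
  have hcN := (mem_right_of_meet hM hi hc hic hc').1
  obtain ⟨x, hx, hxa⟩ := hia
  obtain ⟨y, hy, hyb⟩ := hib
  obtain ⟨z, hz, hzc⟩ := hic
  have h3 : x = y ∨ x = z ∨ y = z := by
    revert hx hy hz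
    induction e i using Sym2.ind with
    | _ p q =>
      simp only [Sym2.mem_iff]
      rintro (rfl | rfl) (rfl | rfl) (rfl | rfl) <;> simp
  rcases h3 with rfl | rfl | rfl
  · exact Or.inl (hN a haN b hbN ⟨x, hxa, hyb⟩)
  · exact Or.inr (Or.inl (hN a haN c hcN ⟨x, hxa, hzc⟩))
  · exact Or.inr (Or.inr (hN b hbN c hcN ⟨y, hyb, hzc⟩))

/-- In `M ∆ N` an edge meets at most two others, one at each of its ends. -/
theorem not_three_meet {M N : Finset E} (hM : IsMatching e M) (hN : IsMatching e N)
    {i a b c : E} (hi : i ∈ symmDiff M N) (ha : a ∈ symmDiff M N) (hb : b ∈ symmDiff M N)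
    (hc : c ∈ symmDiff M N) (hia : Meet e i a) (hib : Meet e i b) (hic : Meet e i c)
    (ha' : i ≠ a) (hb' : i ≠ b) (hc' : i ≠ c) : a = b ∨ a = c ∨ b = c := by
  by_cases h : i ∈ M
  · exact not_three_meet_aux hM hN h ha hb hc hia hib hic ha' hb' hc'
  · have hiN : i ∈ N := by
      rw [Finset.mem_symmDiff] at hi; tauto
    rw [symmDiff_comm] at ha hb hc
    exact not_three_meet_aux hN hM hiN ha hb hc hia hib hic ha' hb' hc'

/-- `r 0, …, r (k - 1)` are distinct edges in `D`, and each of them meets the next one. The values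
of `r` from `k` on are irrelevant. -/
structure IsPathIn (e : E → Sym2 V) (D : Finset E) (r : ℕ → E) (k : ℕ) : Prop where
  mem : ∀ i < k, r i ∈ D
  inj : ∀ i < k, ∀ j < k, r i = r j → i = j
  meet : ∀ i, i + 1 < k → Meet e (r i) (r (i + 1))

theorem IsPathIn.le_card {D : Finset E} {r : ℕ → E} {k : ℕ} (h : IsPathIn e D r k) :
    k ≤ D.card := by
  have := Finset.card_le_card_of_injOn (s := Finset.range k) (t := D) r
    (fun i hi => h.mem i (by simpa using hi))
    (fun i hi j hj => h.inj i (by simpa using hi) j (by simpa using hj))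
  simpa using this

theorem isPathIn_one {D : Finset E} {a : E} (ha : a ∈ D) : IsPathIn e D (fun _ => a) 1 where
  mem _ _ := ha
  inj i hi j hj _ := by omega
  meet i hi := by omega

theorem IsPathIn.append {D : Finset E} {r : ℕ → E} {k : ℕ} (h : IsPathIn e D r (k + 1)) {f : E}
    (hf : f ∈ D) (hmeet : Meet e (r k) f) (hne : ∀ i < k + 1, r i ≠ f) :
    IsPathIn e D (Function.update r (k + 1) f) (k + 2) where
  mem i hi := by
    by_cases hik : i = k + 1
    · simp [hik, hf]
    · simpa [hik] using h.mem i (by omega)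
  inj i hi j hj hij := by
    by_cases hik : i = k + 1 <;> by_cases hjk : j = k + 1
    · omega
    · simp only [hik, Function.update_self, ne_eq, hjk, not_false_eq_true,
        Function.update_of_ne] at hij
      exact (hne j (by omega) hij.symm).elim
    · simp only [hjk, Function.update_self, ne_eq, hik, not_false_eq_true,
        Function.update_of_ne] at hij
      exact (hne i (by omega) hij).elim
    · simp only [ne_eq, hjk, hik, not_false_eq_true, Function.update_of_ne] at hij
      exact h.inj i (by omega) j (by omega) hij
  meet i hi := by
    by_cases hik : i = k
    · simpa [hik] using hmeet
    · have h1 : i ≠ k + 1 := by omega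
      simpa [hik, h1] using h.meet i (by omega)

theorem IsPathIn.reverse {D : Finset E} {r : ℕ → E} {k : ℕ} (h : IsPathIn e D r (k + 1)) :
    IsPathIn e D (fun i => r (k - i)) (k + 1) where
  mem i hi := h.mem _ (by omega)
  inj i hi j hj hij := by
    have := h.inj _ (by omega) _ (by omega) hij
    omega
  meet i hi := by
    have := h.meet (k - (i + 1)) (by omega)
    rw [show k - (i + 1) + 1 = k - i by omega] at this
    exact this.symm

theorem exists_longest {Q : (ℕ → E) → ℕ → Prop} {r₀ : ℕ → E} {k₀ B : ℕ} (h : Q r₀ k₀)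
    (hB : ∀ r k, Q r k → k ≤ B) : ∃ r k, Q r k ∧ ∀ r' k', Q r' k' → k' ≤ k := by
  obtain ⟨r, hr⟩ := Nat.findGreatest_spec (P := fun k => ∃ r, Q r k) (hB _ _ h) ⟨r₀, h⟩
  exact ⟨r, _, hr, fun r' k' h' => Nat.le_findGreatest (hB _ _ h') ⟨r', h'⟩⟩

/-- A path that cannot be prolonged at either end covers a connected component: its inner edges
already meet two edges of `M ∆ N`, and there is no third one. -/
theorem IsPathIn.isClosedIn {M N : Finset E} (hM : IsMatching e M) (hN : IsMatching e N)
    {r : ℕ → E} {k : ℕ} (h : IsPathIn e (symmDiff M N) r (k + 1))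
    (hfirst : ∀ f ∈ symmDiff M N, Meet e (r 0) f → ∃ j < k + 1, r j = f)
    (hlast : ∀ f ∈ symmDiff M N, Meet e (r k) f → ∃ j < k + 1, r j = f) :
    IsClosedIn e (symmDiff M N) ((Finset.range (k + 1)).image r) := by
  refine ⟨?_, ?_⟩
  · intro x hx
    obtain ⟨i, hi, rfl⟩ := Finset.mem_image.1 hx
    exact h.mem i (by simpa using hi)
  · intro x hx f hf hmeet
    obtain ⟨i, hi, rfl⟩ := Finset.mem_image.1 hx
    rw [Finset.mem_range] at hi
    suffices ∃ j < k + 1, r j = f by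
      obtain ⟨j, hj, rfl⟩ := this
      exact Finset.mem_image_of_mem _ (by simpa using hj)
    by_contra! hcon
    have hi0 : i ≠ 0 := by
      rintro rfl
      obtain ⟨j, hj, hjf⟩ := hfirst f hf hmeet
      exact hcon j hj hjf
    have hik : i ≠ k := by
      rintro rfl
      obtain ⟨j, hj, hjf⟩ := hlast f hf hmeet
      exact hcon j hj hjf
    obtain ⟨i, rfl⟩ := Nat.exists_eq_succ_of_ne_zero hi0
    rcases not_three_meet hM hN (h.mem _ hi) (h.mem i (by omega)) (h.mem (i + 2) (by omega)) hf
      (h.meet i hi).symm (h.meet (i + 1) (by omega)) hmeet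
      (fun hh => by have := h.inj _ hi _ (by omega) hh; omega)
      (fun hh => by have := h.inj _ hi _ (by omega) hh; omega) (hcon _ hi) with hh | hh | hh
    · have := h.inj _ (by omega) _ (by omega) hh; omega
    · exact hcon _ (by omega) hh
    · exact hcon _ (by omega) hh

/-- The symmetric difference of two different matchings has a connected component that is covered
by a path, in this case a longest one. -/
theorem exists_path_isClosedIn {M N : Finset E} (hM : IsMatching e M) (hN : IsMatching e N)
    (hne : M ≠ N) : ∃ r k, IsPathIn e (symmDiff M N) r (k + 1) ∧
      IsClosedIn e (symmDiff M N) ((Finset.range (k + 1)).image r) := by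
  obtain ⟨a, ha⟩ : (symmDiff M N).Nonempty := by
    rw [Finset.nonempty_iff_ne_empty]
    simpa [← Finset.bot_eq_empty, symmDiff_eq_bot] using hne
  obtain ⟨r, k, hr, hmax⟩ := exists_longest (Q := IsPathIn e (symmDiff M N)) (isPathIn_one ha)
    (fun r k h => h.le_card)
  obtain ⟨k, rfl⟩ : ∃ m, k = m + 1 :=
    Nat.exists_eq_succ_of_ne_zero (by have := hmax _ _ (isPathIn_one ha); omega)
  refine ⟨r, k, hr, hr.isClosedIn hM hN (fun f hf hm => ?_) (fun f hf hm => ?_)⟩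
  · by_contra! hcon
    have := hmax _ _ (hr.reverse.append hf (by simpa using hm) (fun i hi => hcon _ (by omega)))
    omega
  · by_contra! hcon
    have := hmax _ _ (hr.append hf hm hcon)
    omega

/-- The component of `M ∆ N` at a vertex `t` covered by `M` only is a path from `t`. It reaches at
most one other vertex that `M` leaves free, since such a vertex is the other end of the path. -/
theorem exists_isClosedIn_of_free {M N : Finset E} (hM : IsMatching e M) (hN : IsMatching e N)
    {t u v : V} {a : E} (ha : a ∈ M) (hta : t ∈ e a) (ht : ∀ i ∈ N, t ∉ e i)
    (hu : ∀ i ∈ M, u ∉ e i) (hv : ∀ i ∈ M, v ∉ e i) (huv : u ≠ v) :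
    ∃ C, IsClosedIn e (symmDiff M N) C ∧ a ∈ C ∧
      ((∀ i ∈ C, u ∉ e i) ∨ (∀ i ∈ C, v ∉ e i)) := by
  have haN : a ∉ N := fun h => ht a h hta
  have haD : a ∈ symmDiff M N := by simp [Finset.mem_symmDiff, ha, haN]
  obtain ⟨r, k, ⟨hr, hr0⟩, hmax⟩ := exists_longest
    (Q := fun r k => IsPathIn e (symmDiff M N) r k ∧ r 0 = a) ⟨isPathIn_one haD, rfl⟩
    (fun r k h => h.1.le_card)
  obtain ⟨k, rfl⟩ : ∃ m, k = m + 1 :=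
    Nat.exists_eq_succ_of_ne_zero (by have := hmax _ _ ⟨isPathIn_one haD, rfl⟩; omega)
  have hlast : ∀ f ∈ symmDiff M N, Meet e (r k) f → ∃ j < k + 1, r j = f := by
    intro f hf hm
    by_contra! hcon
    have := hmax _ _ ⟨hr.append hf hm hcon, by simpa using hr0⟩
    omega
  have hMN : ∀ i < k + 1, r i ∉ M → r i ∈ N := by
    intro i hi h
    have := hr.mem i hi
    rw [Finset.mem_symmDiff] at this
    tauto
  -- two edges of `N` that meet the first edge meet it at its end other than `t`, so they agree
  have hfirst : ∀ f ∈ symmDiff M N, Meet e (r 0) f → ∃ j < k + 1, r j = f := by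
    intro f hf hm
    rcases Nat.eq_zero_or_pos k with rfl | hk
    · exact hlast f hf hm
    by_cases hfa : r 0 = f
    · exact ⟨0, by omega, hfa⟩
    refine ⟨1, by omega, ?_⟩
    have h1 := hr.meet 0 (by omega)
    have hne1 : r 0 ≠ r (0 + 1) := fun hh => by
      have := hr.inj _ (by omega) _ (by omega) hh; omega
    have hN1 := (mem_right_of_meet hM (hr0 ▸ ha) (hr.mem 1 (by omega)) h1 hne1).1
    have hNf := (mem_right_of_meet hM (hr0 ▸ ha) hf hm hfa).1
    rw [hr0] at h1 hm
    obtain ⟨x, hx, hx1⟩ := h1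
    obtain ⟨y, hy, hyf⟩ := hm
    have hxt : t ≠ x := fun hh => ht _ hN1 (hh ▸ hx1)
    have hyt : t ≠ y := fun hh => ht _ hNf (hh ▸ hyf)
    have e1 := (Sym2.mem_and_mem_iff hxt).1 ⟨hta, hx⟩
    have e2 := (Sym2.mem_and_mem_iff hyt).1 ⟨hta, hy⟩
    obtain rfl : x = y := Sym2.congr_right.1 (e1.symm.trans e2)
    exact hN _ hN1 _ hNf ⟨x, hx1, hyf⟩
  -- a free vertex of `M` on the path is covered by its last edge
  have hend : ∀ z, (∀ i ∈ M, z ∉ e i) → ∀ i < k + 1, z ∈ e (r i) → 0 < i ∧ i = k := by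
    intro z hz i hi hzi
    have hiM : r i ∉ M := fun h => hz _ h hzi
    have hi0 : i ≠ 0 := by
      rintro rfl
      exact hiM (hr0 ▸ ha)
    refine ⟨by omega, ?_⟩
    by_contra hik
    obtain ⟨i, rfl⟩ := Nat.exists_eq_succ_of_ne_zero hi0
    have hiN := hMN _ hi hiM
    have hm1 := (hr.meet i hi).symm
    have hm2 := hr.meet (i + 1) (by omega)
    have h1 := (mem_right_of_meet hN hiN (symmDiff_comm M N ▸ hr.mem i (by omega)) hm1
      (fun hh => by have := hr.inj _ hi _ (by omega) hh; omega)).1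
    have h2 := (mem_right_of_meet hN hiN (symmDiff_comm M N ▸ hr.mem (i + 2) (by omega)) hm2
      (fun hh => by have := hr.inj _ hi _ (by omega) hh; omega)).1
    obtain ⟨x, hx, hx1⟩ := hm1
    obtain ⟨y, hy, hyf⟩ := hm2
    have hxt : z ≠ x := fun hh => hz _ h1 (hh ▸ hx1)
    have hyt : z ≠ y := fun hh => hz _ h2 (hh ▸ hyf)
    have e1 := (Sym2.mem_and_mem_iff hxt).1 ⟨hzi, hx⟩
    have e2 := (Sym2.mem_and_mem_iff hyt).1 ⟨hzi, hy⟩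
    obtain rfl : x = y := Sym2.congr_right.1 (e1.symm.trans e2)
    have := hr.inj _ (by omega) _ (by omega) (hM _ h1 _ h2 ⟨x, hx1, hyf⟩)
    omega
  refine ⟨_, hr.isClosedIn hM hN hfirst hlast, ?_, ?_⟩
  · rw [← hr0]
    exact Finset.mem_image_of_mem _ (by simp)
  · by_contra! hcon
    obtain ⟨⟨x, hx, hux⟩, y, hy, hvy⟩ := hcon
    obtain ⟨i, hi, rfl⟩ := Finset.mem_image.1 hx
    obtain ⟨j, hj, rfl⟩ := Finset.mem_image.1 hy
    obtain ⟨h0, rfl⟩ := hend u hu i (by simpa using hi) hux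
    obtain ⟨-, rfl⟩ := hend v hv j (by simpa using hj) hvy
    -- the last edge joins `u` and `v`, so the edge of `M` before it covers one of them
    obtain ⟨j, rfl⟩ := Nat.exists_eq_succ_of_ne_zero h0.ne'
    have hjN := hMN _ (by omega) (fun h => hu _ h hux)
    have hm := (hr.meet j (by omega)).symm
    have h1 := (mem_right_of_meet hN hjN (symmDiff_comm M N ▸ hr.mem j (by omega)) hm
      (fun hh => by have := hr.inj _ (by omega) _ (by omega) hh; omega)).1
    obtain ⟨x, hx, hx1⟩ := hm
    have e1 := (Sym2.mem_and_mem_iff huv).1 ⟨hux, hvy⟩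
    rw [e1, Sym2.mem_iff] at hx
    rcases hx with rfl | rfl
    · exact hu _ h1 hx1
    · exact hv _ h1 hx1

end Multigraph

section Edmonds

open scoped Classical

variable {V E : Type*} {e : E → Sym2 V}

/-! ### Matchings of maximum weight -/

theorem sum_exchange_add (w : E → ℝ) {M N C : Finset E} :
    ∑ i ∈ exchange M N C, w i + ∑ i ∈ exchange N M C, w i = ∑ i ∈ M, w i + ∑ i ∈ N, w i := by
  have hd : ∀ M N : Finset E, Disjoint (M \ C) (N ∩ C) := fun M N =>
    Finset.disjoint_left.2 fun i hi hi' => (Finset.mem_sdiff.1 hi).2 (Finset.mem_inter.1 hi').2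
  rw [exchange, exchange, Finset.sum_union (hd M N), Finset.sum_union (hd N M),
    ← Finset.sum_inter_add_sum_sdiff M C w, ← Finset.sum_inter_add_sum_sdiff N C w]
  ring

/-- A matching of maximum weight. -/
def IsOptimal (e : E → Sym2 V) (w : E → ℝ) (M : Finset E) : Prop :=
  IsMatching e M ∧ ∀ N, IsMatching e N → ∑ i ∈ N, w i ≤ ∑ i ∈ M, w i

theorem exists_isOptimal [Finite E] (e : E → Sym2 V) (w : E → ℝ) : ∃ M, IsOptimal e w M := by
  have := Fintype.ofFinite E
  obtain ⟨M, hM, hmax⟩ := Finset.exists_max_image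
    (Finset.univ.filter (IsMatching e)) (fun M => ∑ i ∈ M, w i)
    ⟨∅, by simp [isMatching_empty]⟩
  exact ⟨M, (Finset.mem_filter.1 hM).2, fun N hN => hmax N (by simp [hN])⟩

theorem IsOptimal.exchange {w : E → ℝ} {M N C : Finset E} (hM : IsOptimal e w M)
    (hN : IsOptimal e w N) (hC : IsClosedIn e (symmDiff M N) C) :
    IsOptimal e w (exchange M N C) := by
  have h1 := hM.1.exchange hN.1 hC
  have h2 := hN.1.exchange hM.1 (symmDiff_comm M N ▸ hC)
  have h3 := sum_exchange_add w (M := M) (N := N) (C := C)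
  refine ⟨h1, fun K hK => ?_⟩
  have := hM.2 K hK
  have := hN.2 _ h2
  linarith

/-- The step of Gallai's lemma: when every vertex is left free by some optimal matching, the
relation "no optimal matching leaves both vertices free" is transitive. Given an optimal `M` that
leaves `u` and `v` free and an optimal `N` that leaves `t` free, exchanging along the component of
`M ∆ N` at `t` gives an optimal matching that leaves `t` and one of `u`, `v` free. -/
theorem not_both_free_trans {w : E → ℝ} (hfree : ∀ v, ∃ N, IsOptimal e w N ∧ ∀ i ∈ N, v ∉ e i)
    {u t v : V}
    (hut : u = t ∨ ∀ M, IsOptimal e w M → ¬ ((∀ i ∈ M, u ∉ e i) ∧ ∀ i ∈ M, t ∉ e i))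
    (htv : t = v ∨ ∀ M, IsOptimal e w M → ¬ ((∀ i ∈ M, t ∉ e i) ∧ ∀ i ∈ M, v ∉ e i)) :
    u = v ∨ ∀ M, IsOptimal e w M → ¬ ((∀ i ∈ M, u ∉ e i) ∧ ∀ i ∈ M, v ∉ e i) := by
  rcases hut with rfl | hut
  · exact htv
  rcases htv with rfl | htv
  · exact Or.inr hut
  refine or_iff_not_imp_left.2 fun huv M hM ⟨hMu, hMv⟩ => ?_
  obtain ⟨N, hN, hNt⟩ := hfree t
  obtain ⟨a, ha, hta⟩ : ∃ a ∈ M, t ∈ e a := by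
    by_contra! hcon
    exact hut M hM ⟨hMu, hcon⟩
  obtain ⟨C, hC, haC, hCuv⟩ := exists_isClosedIn_of_free hM.1 hN.1 ha hta hNt hMu hMv huv
  have hopt := hM.exchange hN hC
  have ht : ∀ i ∈ MatchingArrangement.exchange M N C, t ∉ e i := by
    intro i hi hti
    rcases mem_exchange.1 hi with ⟨hi, hiC⟩ | ⟨hi, -⟩
    · exact hiC (hM.1 a ha i hi ⟨t, hta, hti⟩ ▸ haC)
    · exact hNt i hi hti
  have hz : ∀ z, (∀ i ∈ M, z ∉ e i) → (∀ i ∈ C, z ∉ e i) →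
      ∀ i ∈ MatchingArrangement.exchange M N C, z ∉ e i := by
    intro z hzM hzC i hi
    rcases mem_exchange.1 hi with ⟨hi, -⟩ | ⟨-, hi⟩
    · exact hzM i hi
    · exact hzC i hi
  rcases hCuv with h | h
  · exact hut _ hopt ⟨hz u hMu h, ht⟩
  · exact htv _ hopt ⟨ht, hz v hMv h⟩

theorem IsMatching.card_biUnion {B : Finset E} (hl : ∀ i, ¬ (e i).IsDiag) (hB : IsMatching e B) :
    (B.biUnion fun i => (e i).toFinset).card = 2 * B.card := by
  rw [Finset.card_biUnion, Finset.sum_congr rfl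
    (fun i _ => Sym2.card_toFinset_of_not_isDiag (e i) (hl i))]
  · simp [mul_comm]
  · intro i hi j hj hij
    refine Finset.disjoint_left.2 fun v hv hv' => hij (hB i hi j hj ⟨v, ?_, ?_⟩)
    · simpa using hv
    · simpa using hv'

/-- The edges of `M` with both ends in `S`. -/
noncomputable def inside (e : E → Sym2 V) (S : Finset V) (M : Finset E) : Finset E :=
  M.filter fun i => ∀ v ∈ e i, v ∈ S

theorem mem_inside {S : Finset V} {M : Finset E} {i : E} :
    i ∈ inside e S M ↔ i ∈ M ∧ ∀ v ∈ e i, v ∈ S := by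
  simp [inside]

theorem inside_subset (S : Finset V) (M : Finset E) : inside e S M ⊆ M :=
  Finset.filter_subset _ M

theorem inside_mono (S : Finset V) {M N : Finset E} (h : M ⊆ N) : inside e S M ⊆ inside e S N :=
  Finset.filter_subset_filter _ h

theorem IsMatching.two_mul_card_inside_le (hl : ∀ i, ¬ (e i).IsDiag) {M : Finset E}
    (hM : IsMatching e M) (S : Finset V) : 2 * (inside e S M).card ≤ S.card := by
  rw [← (hM.mono (inside_subset S M)).card_biUnion hl]
  refine Finset.card_le_card fun v hv => ?_
  obtain ⟨i, hi, hv⟩ := Finset.mem_biUnion.1 hv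
  exact (mem_inside.1 hi).2 v (by simpa using hv)

theorem IsOptimal.filter_pos {w : E → ℝ} (hw : ∀ i, 0 ≤ w i) {M : Finset E}
    (hM : IsOptimal e w M) : IsOptimal e w (M.filter fun i => 0 < w i) := by
  refine ⟨hM.1.mono (Finset.filter_subset _ M), fun N hN => (hM.2 N hN).trans_eq ?_⟩
  rw [Finset.sum_filter]
  refine Finset.sum_congr rfl fun i _ => ?_
  split_ifs with h
  · rfl
  · exact le_antisymm (not_lt.1 h) (hw i)

/-- For every nonzero weight one of Edmonds' inequalities is tight on all matchings of maximum
weight. If the first two kinds fail, then by Gallai's lemma the edges of positive weight in a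
matching of maximum weight leave exactly one vertex free in a component `S` of the graph of all
edges of positive weight. -/
theorem exists_tight [Finite V] (hl : ∀ i, ¬ (e i).IsDiag) {w : E → ℝ} (hw : w ≠ 0) :
    (∃ i, ∀ M, IsOptimal e w M → i ∉ M) ∨
    (∃ v, ∀ M, IsOptimal e w M → ∃ i ∈ M, v ∈ e i) ∨
    ∃ (k : ℕ) (S : Finset V), 1 ≤ k ∧ S.card = 2 * k + 1 ∧
      ∀ M, IsOptimal e w M → (inside e S M).card = k := by
  refine or_iff_not_imp_left.2 fun h1 => or_iff_not_imp_left.2 fun h2 => ?_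
  push Not at h1 h2
  have := Fintype.ofFinite V
  -- an edge of negative weight would lie in no optimal matching
  have hnn : ∀ i, 0 ≤ w i := by
    intro i
    obtain ⟨M, hM, hi⟩ := h1 i
    have h := hM.2 _ (hM.1.mono (Finset.erase_subset i M))
    have h' := Finset.add_sum_erase M w hi
    linarith
  obtain ⟨i₀, hi₀⟩ : ∃ i, 0 < w i := by
    by_contra! hcon
    exact hw (funext fun i => le_antisymm (hcon i) (hnn i))
  let H : SimpleGraph V :=
    { Adj := fun a b => ∃ i, 0 < w i ∧ e i = s(a, b)
      symm := ⟨fun a b ⟨i, hi, h⟩ => ⟨i, hi, h.trans Sym2.eq_swap⟩⟩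
      loopless := ⟨fun a ⟨i, _, h⟩ => hl i (h ▸ rfl)⟩ }
  -- Gallai's lemma on the components of `H`
  have gallai : ∀ u v, H.Reachable u v →
      u = v ∨ ∀ M, IsOptimal e w M → ¬ ((∀ i ∈ M, u ∉ e i) ∧ ∀ i ∈ M, v ∉ e i) := by
    rintro u v ⟨p⟩
    induction p with
    | nil => exact Or.inl rfl
    | @cons a b c hab p ih =>
      refine not_both_free_trans h2 (Or.inr fun M hM ⟨ha, hb⟩ => ?_) ih
      -- an edge of positive weight between two free vertices could be added
      obtain ⟨i, hi, hei⟩ := hab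
      have hiM : i ∉ M := fun h => ha i h (by simp [hei])
      have hfree : ∀ j ∈ M, ¬ Meet e i j := by
        rintro j hj ⟨x, hx, hxj⟩
        rw [hei, Sym2.mem_iff] at hx
        rcases hx with rfl | rfl
        · exact ha j hj hxj
        · exact hb j hj hxj
      have hins : IsMatching e (insert i M) := by
        intro j hj j' hj' hm
        rcases Finset.mem_insert.1 hj with hj | hj <;>
          rcases Finset.mem_insert.1 hj' with hj' | hj'
        · exact hj.trans hj'.symm
        · exact (hfree _ hj' (hj ▸ hm)).elim
        · exact (hfree _ hj (hj' ▸ hm.symm)).elim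
        · exact hM.1 _ hj _ hj' hm
      have := hM.2 _ hins
      rw [Finset.sum_insert hiM] at this
      linarith
  obtain ⟨a, b, hab⟩ : ∃ a b, e i₀ = s(a, b) := by
    induction e i₀ using Sym2.ind with
    | _ a b => exact ⟨a, b, rfl⟩
  have hne : a ≠ b := by
    rintro rfl
    exact hl i₀ (hab ▸ rfl)
  have hadj : H.Adj a b := ⟨i₀, hi₀, hab⟩
  let S : Finset V := Finset.univ.filter (H.Reachable a)
  have hS : ∀ v, v ∈ S ↔ H.Reachable a v := by simp [S]
  have hS2 : 1 < S.card :=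
    Finset.one_lt_card.2 ⟨a, (hS a).2 (SimpleGraph.Reachable.refl a), b, (hS b).2 hadj.reachable,
      hne⟩
  -- Edges of weight zero may leave the component `S`, so vertices of `S` are counted as covered
  -- only when an edge of positive weight covers them.
  let pos : Finset E → Finset E := fun M => M.filter fun i => 0 < w i
  let cov : Finset E → Finset V := fun M => (inside e S (pos M)).biUnion fun i => (e i).toFinset
  have hcard : ∀ M, IsOptimal e w M → (cov M).card = 2 * (inside e S (pos M)).card :=
    fun M hM => IsMatching.card_biUnion hl
      (hM.1.mono ((inside_subset _ _).trans (Finset.filter_subset _ _)))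
  have hcovS : ∀ M, cov M ⊆ S := by
    intro M v hv
    obtain ⟨i, hi, hv⟩ := Finset.mem_biUnion.1 hv
    exact (mem_inside.1 hi).2 v (by simpa using hv)
  have hfree : ∀ M, ∀ v ∈ S, v ∉ cov M → ∀ i ∈ pos M, v ∉ e i := by
    intro M v hv hvc i hi hvi
    refine hvc (Finset.mem_biUnion.2 ⟨i, mem_inside.2 ⟨hi, fun x hx => ?_⟩, by simpa⟩)
    by_cases hxv : v = x
    · exact hxv ▸ hv
    · have hvx : H.Adj v x :=
        ⟨i, (Finset.mem_filter.1 hi).2, (Sym2.mem_and_mem_iff hxv).1 ⟨hvi, hx⟩⟩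
      exact (hS x).2 (((hS v).1 hv).trans hvx.reachable)
  have hle : ∀ M, IsOptimal e w M → S.card ≤ 2 * (inside e S (pos M)).card + 1 := by
    intro M hM
    rw [← hcard M hM, ← Finset.card_sdiff_add_card_eq_card (hcovS M), add_comm]
    refine Nat.add_le_add_left (Finset.card_le_one.2 fun u hu v hv => ?_) _
    rw [Finset.mem_sdiff] at hu hv
    refine (gallai u v (((hS u).1 hu.1).symm.trans ((hS v).1 hv.1))).resolve_right fun h => ?_
    exact h _ (hM.filter_pos hnn) ⟨hfree M u hu.1 hu.2, hfree M v hv.1 hv.2⟩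
  obtain ⟨M₀, hM₀, hM₀a⟩ := h2 a
  have hlt : 2 * (inside e S (pos M₀)).card < S.card := by
    rw [← hcard M₀ hM₀]
    refine Finset.card_lt_card ⟨hcovS M₀, fun h => ?_⟩
    obtain ⟨i, hi, hai⟩ := Finset.mem_biUnion.1 (h ((hS a).2 (SimpleGraph.Reachable.refl a)))
    exact hM₀a i (Finset.filter_subset _ _ (inside_subset _ _ hi)) (by simpa using hai)
  have hle₀ := hle M₀ hM₀
  refine ⟨(inside e S (pos M₀)).card, S, by omega, by omega, fun M hM => ?_⟩
  have hM1 := hle M hM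
  have hM2 : (inside e S (pos M)).card ≤ (inside e S M).card :=
    Finset.card_le_card (inside_mono S (Finset.filter_subset _ _))
  have hM3 := hM.1.two_mul_card_inside_le hl S
  omega

/-! ### Edmonds' theorem -/

/-- The polytope of Edmonds' inequalities, for a multigraph with end point map `e`. The polyhedron
`matchingPolyhedron G N` is, by definition, the case `e = fun i => (N.symm i : Sym2 V)`. -/
def edgePolytope [Fintype E] (e : E → Sym2 V) : Set (E → ℝ) :=
  {x | (∀ i, 0 ≤ x i) ∧
    (∀ v : V, ∑ i with v ∈ e i, x i ≤ 1) ∧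
    (∀ (k : ℕ) (S : Finset V), S.card = 2 * k + 1 →
      ∑ i with (∀ v ∈ e i, v ∈ S), x i ≤ (k : ℝ))}

/-- The characteristic vector of a set of edges. -/
noncomputable def chi (M : Finset E) : E → ℝ := fun i => if i ∈ M then 1 else 0

variable [Fintype E]

theorem sum_mul_chi (w : E → ℝ) (M : Finset E) : ∑ i, w i * chi M i = ∑ i ∈ M, w i := by
  simp [chi]

theorem sum_filter_chi (p : E → Prop) [DecidablePred p] (M : Finset E) :
    ∑ i with p i, chi M i = ((M.filter p).card : ℝ) := by
  rw [← Finset.sum_filter_add_sum_filter_not (Finset.univ.filter p) (· ∈ M), Finset.filter_filter,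
    Finset.filter_filter, Finset.sum_eq_zero (s := Finset.univ.filter fun i => p i ∧ i ∉ M),
    add_zero, Finset.card_eq_sum_ones, Nat.cast_sum]
  · refine Finset.sum_congr (by ext i; simp [and_comm]) fun i hi => ?_
    simp_all [chi]
  · intro i hi
    simp_all [chi]

theorem chi_mem_edgePolytope (hl : ∀ i, ¬ (e i).IsDiag) {M : Finset E} (hM : IsMatching e M) :
    chi M ∈ edgePolytope e := by
  refine ⟨fun i => ?_, fun v => ?_, fun k S hS => ?_⟩
  · unfold chi; split_ifs <;> norm_num
  · rw [sum_filter_chi]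
    norm_cast
    refine Finset.card_le_one.2 fun i hi j hj => ?_
    rw [Finset.mem_filter] at hi hj
    exact hM i hi.1 j hj.1 ⟨v, hi.2, hj.2⟩
  · rw [sum_filter_chi]
    norm_cast
    have h := hM.two_mul_card_inside_le hl S
    have h' : (M.filter fun i => ∀ v ∈ e i, v ∈ S).card = (inside e S M).card :=
      congrArg _ (by ext; simp [mem_inside])
    omega

/-- An inequality `∑ i, a i * x i ≤ β` of Edmonds' system, valid on the polytope, that is tight on
all matchings of maximum weight, but not on all matchings. -/
theorem exists_tight_inequality [Finite V] (hl : ∀ i, ¬ (e i).IsDiag) {w : E → ℝ} (hw : w ≠ 0) :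
    ∃ (a : E → ℝ) (β : ℝ), (∀ x ∈ edgePolytope e, ∑ i, a i * x i ≤ β) ∧
      (∀ M, IsOptimal e w M → ∑ i ∈ M, a i = β) ∧ ∃ M, IsMatching e M ∧ ∑ i ∈ M, a i < β := by
  have hsum : ∀ (p : E → Prop) [DecidablePred p] (x : E → ℝ),
      ∑ i, (if p i then (1 : ℝ) else 0) * x i = ∑ i with p i, x i := by
    intro p _ x; simp [Finset.sum_filter]
  have hsum' : ∀ (p : E → Prop) [DecidablePred p] (M : Finset E),
      ∑ i ∈ M, (if p i then (1 : ℝ) else 0) = ((M.filter p).card : ℝ) := by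
    intro p _ M; simp
  rcases exists_tight hl hw with ⟨j, hj⟩ | ⟨v, hv⟩ | ⟨k, S, hk, hS, h⟩
  · refine ⟨fun i => if i = j then -1 else 0, 0, fun x hx => ?_, fun M hM => ?_, {j}, ?_, ?_⟩
    · simpa using hx.1 j
    · simpa using hj M hM
    · intro a ha b hb _
      simp_all
    · simp
  · refine ⟨fun i => if v ∈ e i then 1 else 0, 1, fun x hx => ?_, fun M hM => ?_, ∅,
      isMatching_empty, by simp⟩
    · exact (hsum _ x).trans_le (hx.2.1 v)
    · refine (hsum' _ M).trans ?_
      obtain ⟨i, hi, hvi⟩ := hv M hM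
      norm_cast
      refine Finset.card_eq_one.2 ⟨i, Finset.eq_singleton_iff_unique_mem.2 ⟨by simp [hi, hvi], ?_⟩⟩
      intro j hj
      rw [Finset.mem_filter] at hj
      exact hM.1 j hj.1 i hi ⟨v, hj.2, hvi⟩
  · refine ⟨fun i => if ∀ v ∈ e i, v ∈ S then 1 else 0, k, fun x hx => ?_, fun M hM => ?_, ∅,
      isMatching_empty, by simpa using Nat.pos_of_ne_zero (by omega)⟩
    · exact (hsum _ x).trans_le (hx.2.2 k S hS)
    · refine (hsum' _ M).trans ?_
      rw [← h M hM]
      exact congrArg _ (congrArg _ (by ext; simp [mem_inside]))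

/-- A matching of maximum weight maximizes the weight over the whole polytope. Subtracting from the
weight a tight inequality, with the largest multiple that keeps the optimal matchings optimal,
makes a further matching optimal; the induction is on the number of the matchings that are not
optimal. -/
theorem IsOptimal.sum_mul_le [Finite V] (hl : ∀ i, ¬ (e i).IsDiag) {w : E → ℝ} {M : Finset E}
    (hM : IsOptimal e w M) {x : E → ℝ} (hx : x ∈ edgePolytope e) :
    ∑ i, w i * x i ≤ ∑ i ∈ M, w i := by
  induction hn : (Finset.univ.filter fun N => IsMatching e N ∧ ¬ IsOptimal e w N).card
    using Nat.strong_induction_on generalizing w with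
  | _ n ih =>
    by_cases hw : w = 0
    · simp [hw]
    obtain ⟨a, β, hval, htight, K, hK, hKβ⟩ := exists_tight_inequality hl hw
    have hvalM : ∀ N, IsMatching e N → ∑ i ∈ N, a i ≤ β := fun N hN => by
      simpa [sum_mul_chi] using hval _ (chi_mem_edgePolytope hl hN)
    obtain ⟨L, hL, hmin⟩ := Finset.exists_min_image
      (Finset.univ.filter fun N => IsMatching e N ∧ ∑ i ∈ N, a i < β)
      (fun N => (∑ i ∈ M, w i - ∑ i ∈ N, w i) / (β - ∑ i ∈ N, a i)) ⟨K, by simp [hK, hKβ]⟩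
    simp only [Finset.mem_filter, Finset.mem_univ, true_and] at hL hmin
    set t := (∑ i ∈ M, w i - ∑ i ∈ L, w i) / (β - ∑ i ∈ L, a i) with ht
    have hLpos : 0 < β - ∑ i ∈ L, a i := by linarith [hL.2]
    have ht0 : 0 ≤ t := div_nonneg (by linarith [hM.2 L hL.1]) hLpos.le
    let w' : E → ℝ := fun i => w i - t * a i
    have hw' : ∀ N : Finset E, ∑ i ∈ N, w' i = ∑ i ∈ N, w i - t * ∑ i ∈ N, a i := by
      intro N; simp [w', Finset.sum_sub_distrib, Finset.mul_sum]
    have hbound : ∀ N, IsMatching e N → ∑ i ∈ N, w' i ≤ ∑ i ∈ M, w i - t * β := by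
      intro N hN
      rw [hw']
      rcases (hvalM N hN).lt_or_eq with h | h
      · have h1 := hmin N ⟨hN, h⟩
        rw [le_div_iff₀ (by linarith)] at h1
        linarith
      · rw [h]; linarith [hM.2 N hN]
    have hopt : ∀ N, IsMatching e N → ∑ i ∈ N, w' i = ∑ i ∈ M, w i - t * β →
        IsOptimal e w' N := fun N hN h => ⟨hN, fun N' hN' => h ▸ hbound N' hN'⟩
    have hold : ∀ N, IsOptimal e w N → IsOptimal e w' N := fun N hN =>
      hopt N hN.1 (by rw [hw', htight N hN, le_antisymm (hM.2 N hN.1) (hN.2 M hM.1)])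
    have hnew : IsOptimal e w' L := by
      refine hopt L hL.1 ?_
      rw [hw']
      have : t * (β - ∑ i ∈ L, a i) = ∑ i ∈ M, w i - ∑ i ∈ L, w i := by
        rw [ht, div_mul_cancel₀ _ hLpos.ne']
      linarith
    have hlt : (Finset.univ.filter fun N => IsMatching e N ∧ ¬ IsOptimal e w' N).card < n := by
      rw [← hn]
      refine Finset.card_lt_card ⟨fun N hN => ?_, fun h => ?_⟩
      · simp only [Finset.mem_filter, Finset.mem_univ, true_and] at hN ⊢
        exact ⟨hN.1, fun h => hN.2 (hold N h)⟩
      · have h1 := h (Finset.mem_filter.2 ⟨Finset.mem_univ L, hL.1, fun hh =>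
          hL.2.ne (htight L hh)⟩)
        exact (Finset.mem_filter.1 h1).2.2 hnew
    have h1 := ih _ hlt (hold M hM) rfl
    rw [hw', htight M hM] at h1
    have h2 : ∑ i, w' i * x i = ∑ i, w i * x i - t * ∑ i, a i * x i := by
      simp [w', sub_mul, Finset.sum_sub_distrib, Finset.mul_sum, mul_assoc]
    have h3 := mul_le_mul_of_nonneg_left (hval x hx) ht0
    linarith

theorem edgePolytope_subset_convexHull [Finite V] (hl : ∀ i, ¬ (e i).IsDiag) :
    edgePolytope e ⊆ convexHull ℝ (chi '' {M | IsMatching e M}) := by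
  intro x hx
  by_contra hcon
  obtain ⟨f, s, hf, hs⟩ := geometric_hahn_banach_closed_point (convex_convexHull ℝ _)
    ((Set.toFinite (chi '' {M | IsMatching e M})).isClosed_convexHull ℝ) hcon
  have hfx : ∀ y : E → ℝ, f y = ∑ i, f (Pi.single i 1) * y i := by
    intro y
    conv_lhs => rw [← Finset.univ_sum_single y, map_sum]
    refine Finset.sum_congr rfl fun i _ => ?_
    rw [mul_comm, ← smul_eq_mul, ← map_smul, ← Pi.single_smul, smul_eq_mul, mul_one]
  obtain ⟨M, hM⟩ := exists_isOptimal e (fun i => f (Pi.single i 1))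
  have h1 := hM.sum_mul_le hl hx
  have h2 := hf _ (subset_convexHull ℝ _ ⟨M, hM.1, rfl⟩)
  rw [hfx, sum_mul_chi] at h2
  rw [hfx] at hs
  linarith

theorem convex_edgePolytope : Convex ℝ (edgePolytope e) := by
  have key : ∀ (s : Finset E) (c : ℝ) (x y : E → ℝ) (a b : ℝ), 0 ≤ a → 0 ≤ b → a + b = 1 →
      ∑ i ∈ s, x i ≤ c → ∑ i ∈ s, y i ≤ c → ∑ i ∈ s, (a • x + b • y) i ≤ c := by
    intro s c x y a b ha hb hab hx hy
    simp only [Pi.add_apply, Pi.smul_apply, smul_eq_mul, Finset.sum_add_distrib, ← Finset.mul_sum]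
    have hc : c = a * c + b * c := by rw [← add_mul, hab, one_mul]
    rw [hc]
    gcongr
  intro x hx y hy a b ha hb hab
  refine ⟨fun i => ?_, fun v => ?_, fun k S hS => ?_⟩
  · have := hx.1 i
    have := hy.1 i
    simp only [Pi.add_apply, Pi.smul_apply, smul_eq_mul]
    positivity
  · exact key _ _ _ _ _ _ ha hb hab (hx.2.1 v) (hy.2.1 v)
  · exact key _ _ _ _ _ _ ha hb hab (hx.2.2 k S hS) (hy.2.2 k S hS)

/-- Edmonds' theorem: the extreme points are characteristic vectors of matchings. -/
theorem exists_chi_of_mem_extremePoints [Finite V] (hl : ∀ i, ¬ (e i).IsDiag) {x : E → ℝ}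
    (hx : x ∈ (edgePolytope e).extremePoints ℝ) : ∃ M, IsMatching e M ∧ x = chi M := by
  have h : edgePolytope e = convexHull ℝ (chi '' {M | IsMatching e M}) := by
    refine (edgePolytope_subset_convexHull hl).antisymm (convexHull_min ?_ convex_edgePolytope)
    rintro _ ⟨M, hM, rfl⟩
    exact chi_mem_edgePolytope hl hM
  rw [h] at hx
  obtain ⟨M, hM, rfl⟩ := extremePoints_convexHull_subset hx
  exact ⟨M, hM, rfl⟩

end Edmonds

section Edges

open scoped Classical

variable {V E : Type*} {e : E → Sym2 V}

/-! ### Edges of the polytope and alternating chains -/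

/-- The edge sequences that define hyperplanes of the matching arrangement: simple paths, and
simple cycles of even length. Two edges with a common vertex count as a closed sequence, and
`even_of_closed` holds for them trivially. -/
structure IsAlternatingChain (e : E → Sym2 V) {k : ℕ} (r : Fin k → E) : Prop where
  pos : 0 < k
  injective : Function.Injective r
  consecutive : ∀ i j : Fin k, (j : ℕ) = i + 1 → Meet e (r i) (r j)
  simple : ∀ i j : Fin k, i < j → Meet e (r i) (r j) →
    (j : ℕ) = i + 1 ∨ ((i : ℕ) = 0 ∧ (j : ℕ) + 1 = k)
  even_of_closed : ∀ i j : Fin k, i < j → (i : ℕ) = 0 → (j : ℕ) + 1 = k → Meet e (r i) (r j) →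
    Even k

/-- Along a path in `M ∆ N` the edges lie in `M` and in `N` alternately. -/
theorem IsPathIn.chi_sub_chi {M N : Finset E} (hM : IsMatching e M) (hN : IsMatching e N)
    {r : ℕ → E} {k : ℕ} (hr : IsPathIn e (symmDiff M N) r k) {i : ℕ} (hi : i < k) :
    chi M (r i) - chi N (r i) = (-1) ^ i * (chi M (r 0) - chi N (r 0)) := by
  induction i with
  | zero => simp
  | succ i ih =>
    have h1 := hr.mem i (by omega)
    have h2 := hr.mem (i + 1) hi
    have h3 := mem_left_iff_of_meet hM hN h1 h2 (hr.meet i hi)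
      (fun hh => by have := hr.inj _ (by omega) _ hi hh; omega)
    rw [pow_succ, mul_right_comm, ← ih (by omega)]
    rw [Finset.mem_symmDiff] at h1 h2
    by_cases h : r i ∈ M
    · have h4 : r i ∉ N := by tauto
      have h5 : r (i + 1) ∈ N ∧ r (i + 1) ∉ M := by tauto
      simp [chi, h, h4, h5]
    · have h4 : r i ∈ N := by tauto
      have h5 : r (i + 1) ∉ N ∧ r (i + 1) ∈ M := by tauto
      simp [chi, h, h4, h5]

theorem chi_ne_chi {M N : Finset E} {i : E} (hi : i ∈ symmDiff M N) : chi M i ≠ chi N i := by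
  rw [Finset.mem_symmDiff] at hi
  rcases hi with ⟨h1, h2⟩ | ⟨h1, h2⟩ <;> simp [chi, h1, h2]

theorem IsPathIn.isAlternatingChain {M N : Finset E} (hM : IsMatching e M) (hN : IsMatching e N)
    {r : ℕ → E} {k : ℕ} (hr : IsPathIn e (symmDiff M N) r (k + 1)) :
    IsAlternatingChain e (fun i : Fin (k + 1) => r i) where
  pos := k.succ_pos
  injective i j hij := Fin.ext (hr.inj _ i.2 _ j.2 hij)
  consecutive i j hij := by
    have := hr.meet i (by omega)
    rwa [← hij] at this
  simple i j hij hmeet := by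
    obtain ⟨i, hi⟩ := i
    obtain ⟨j, hj⟩ := j
    simp only [Fin.mk_lt_mk] at hij hmeet ⊢
    have hne : ∀ a < k + 1, ∀ b < k + 1, a ≠ b → r a ≠ r b := fun a ha b hb hab h =>
      hab (hr.inj a ha b hb h)
    by_contra! hcon
    by_cases hi0 : i = 0
    · -- `r j` meets `r (j - 1)`, `r (j + 1)` and `r i`
      obtain ⟨j, rfl⟩ := Nat.exists_eq_succ_of_ne_zero (show j ≠ 0 by omega)
      rcases not_three_meet hM hN (hr.mem _ hj) (hr.mem j (by omega)) (hr.mem (j + 2) (by omega))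
        (hr.mem i hi) (hr.meet j hj).symm (hr.meet (j + 1) (by omega)) hmeet.symm
        (hne _ hj _ (by omega) (by omega)) (hne _ hj _ (by omega) (by omega))
        (hne _ hj _ (by omega) (by omega)) with h | h | h
      · exact hne _ (by omega) _ (by omega) (by omega) h
      · exact hne _ (by omega) _ (by omega) (by omega) h
      · exact hne _ (by omega) _ (by omega) (by omega) h
    · -- `r i` meets `r (i - 1)`, `r (i + 1)` and `r j`
      obtain ⟨i, rfl⟩ := Nat.exists_eq_succ_of_ne_zero hi0
      rcases not_three_meet hM hN (hr.mem _ hi) (hr.mem i (by omega)) (hr.mem (i + 2) (by omega))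
        (hr.mem j hj) (hr.meet i hi).symm (hr.meet (i + 1) (by omega)) hmeet
        (hne _ hi _ (by omega) (by omega)) (hne _ hi _ (by omega) (by omega))
        (hne _ hi _ (by omega) (by omega)) with h | h | h
      · exact hne _ (by omega) _ (by omega) (by omega) h
      · exact hne _ (by omega) _ (by omega) (by omega) h
      · exact hne _ (by omega) _ (by omega) (by omega) h
  even_of_closed i j hij hi0 hjk hmeet := by
    have hjk' : (j : ℕ) = k := by omega
    have hk : 0 < k := by
      have : (i : ℕ) < j := hij
      omega
    simp only [hi0, hjk'] at hmeet
    rcases Nat.even_or_odd k with hev | hodd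
    · -- for even `k` the edges `r 0` and `r k` lie in the same matching
      exfalso
      have h := hr.chi_sub_chi hM hN (lt_add_one k)
      rw [hev.neg_one_pow, one_mul] at h
      have hD0 := hr.mem 0 (by omega)
      have hDk := hr.mem k (by omega)
      have h3 := mem_left_iff_of_meet hM hN hD0 hDk hmeet
        (fun hh => by have := hr.inj _ (by omega) _ (by omega) hh; omega)
      rw [Finset.mem_symmDiff] at hD0 hDk
      by_cases h0 : r 0 ∈ M
      · have h4 : r 0 ∉ N := by tauto
        have h5 : r k ∈ N ∧ r k ∉ M := by tauto
        norm_num [chi, h0, h4, h5] at h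
      · have h4 : r 0 ∈ N := by tauto
        have h5 : r k ∉ N ∧ r k ∈ M := by tauto
        norm_num [chi, h0, h4, h5] at h
    · exact hodd.add_one

namespace IsAlternatingChain

variable {k : ℕ} {r : Fin k → E}

/-- The edges at the positions of parity `p` form a matching. -/
theorem isMatching_image (h : IsAlternatingChain e r) (p : ZMod 2) :
    IsMatching e ((Finset.univ.filter fun i : Fin k => ((i : ℕ) : ZMod 2) = p).image r) := by
  have key : ∀ i j : Fin k, ((i : ℕ) : ZMod 2) = ((j : ℕ) : ZMod 2) → i < j →
      ¬ Meet e (r i) (r j) := by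
    intro i j hp hij hm
    rw [ZMod.natCast_eq_natCast_iff'] at hp
    rcases h.simple i j hij hm with h1 | ⟨h1, h2⟩
    · omega
    · obtain ⟨m, hm⟩ := h.even_of_closed i j hij h1 h2 hm
      omega
  intro a ha b hb hab
  obtain ⟨i, hi, rfl⟩ := Finset.mem_image.1 ha
  obtain ⟨j, hj, rfl⟩ := Finset.mem_image.1 hb
  have hi' := (Finset.mem_filter.1 hi).2
  have hj' := (Finset.mem_filter.1 hj).2
  rcases lt_trichotomy i j with hij | rfl | hij
  · exact (key i j (hi'.trans hj'.symm) hij hab).elim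
  · rfl
  · exact (key j i (hj'.trans hi'.symm) hij hab.symm).elim

theorem chi_image (h : IsAlternatingChain e r) (p : Fin k → Prop) [DecidablePred p] (i : Fin k) :
    chi ((Finset.univ.filter p).image r) (r i) = if p i then 1 else 0 := by
  simp [chi, h.injective.eq_iff]

end IsAlternatingChain

theorem chi_image_of_notMem {k : ℕ} {r : Fin k → E} (s : Finset (Fin k)) {a : E}
    (ha : a ∉ Finset.univ.image r) : chi (s.image r) a = 0 := by
  have : a ∉ s.image r := fun h => ha (Finset.image_subset_image (Finset.subset_univ s) h)
  simp [chi, this]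

variable [Fintype E]

/-- The difference of two adjacent vertices of the polytope is, up to a factor, the normal vector
of a hyperplane of the arrangement. Exchanging the matchings `M` and `N` along one component of
`M ∆ N` gives two matchings with the same sum of characteristic vectors; as the segment from
`chi M` to `chi N` is a face, it contains both, so that there is no second component. -/
theorem exists_isAlternatingChain [Finite V] (hl : ∀ i, ¬ (e i).IsDiag) {u v : E → ℝ}
    (hu : u ∈ (edgePolytope e).extremePoints ℝ) (hv : v ∈ (edgePolytope e).extremePoints ℝ)
    (huv : u ≠ v) (hface : IsExposed ℝ (edgePolytope e) (segment ℝ u v)) :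
    ∃ (k : ℕ) (r : Fin k → E) (s : ℝ), IsAlternatingChain e r ∧ s ≠ 0 ∧
      ∀ α : E → ℝ, ∑ i, α i * u i - ∑ i, α i * v i = s * ∑ i : Fin k, (-1) ^ (i : ℕ) * α (r i) := by
  obtain ⟨M, hM, rfl⟩ := exists_chi_of_mem_extremePoints hl hu
  obtain ⟨N, hN, rfl⟩ := exists_chi_of_mem_extremePoints hl hv
  have hMN : M ≠ N := fun h => huv (h ▸ rfl)
  obtain ⟨r, k, hr, hC⟩ := exists_path_isClosedIn hM hN hMN
  set C := (Finset.range (k + 1)).image r with hCdef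
  have h0C : r 0 ∈ C := Finset.mem_image_of_mem _ (by simp)
  have hp := chi_mem_edgePolytope hl (hM.exchange hN hC)
  have hq := chi_mem_edgePolytope hl (hN.exchange hM (symmDiff_comm M N ▸ hC))
  have hmid : ((1 : ℝ) / 2) • chi (exchange M N C) + ((1 : ℝ) / 2) • chi (exchange N M C) =
      ((1 : ℝ) / 2) • chi M + ((1 : ℝ) / 2) • chi N := by
    funext i
    simp only [Pi.add_apply, Pi.smul_apply, smul_eq_mul, chi, mem_exchange]
    by_cases h1 : i ∈ M <;> by_cases h2 : i ∈ N <;> by_cases h3 : i ∈ C <;> simp [h1, h2, h3]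
  have hseg : chi (exchange M N C) ∈ segment ℝ (chi M) (chi N) :=
    hface.isExtreme.2 hp hq ⟨1 / 2, 1 / 2, by norm_num, by norm_num, by norm_num, rfl⟩
      ⟨1 / 2, 1 / 2, by norm_num, by norm_num, by norm_num, hmid⟩
  have hCD : C = symmDiff M N := by
    refine hC.1.antisymm fun j hj => ?_
    by_contra hjC
    obtain ⟨a, b, -, -, hab, h⟩ := hseg
    have hj' := congrFun h j
    have h0' := congrFun h (r 0)
    have e1 : chi (exchange M N C) j = chi M j := by simp [chi, mem_exchange, hjC]
    have e2 : chi (exchange M N C) (r 0) = chi N (r 0) := by simp [chi, mem_exchange, h0C]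
    simp only [Pi.add_apply, Pi.smul_apply, smul_eq_mul] at hj' h0'
    rw [e1] at hj'
    rw [e2] at h0'
    have hb : b * (chi M j - chi N j) = 0 := by
      linear_combination chi M j * hab - hj'
    have ha : a * (chi M (r 0) - chi N (r 0)) = 0 := by
      linear_combination h0' - chi N (r 0) * hab
    have hb' := (mul_eq_zero.1 hb).resolve_right (sub_ne_zero.2 (chi_ne_chi hj))
    have ha' := (mul_eq_zero.1 ha).resolve_right (sub_ne_zero.2 (chi_ne_chi (hC.1 h0C)))
    rw [ha', hb'] at hab
    norm_num at hab
  refine ⟨k + 1, fun i => r i, chi M (r 0) - chi N (r 0), hr.isAlternatingChain hM hN,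
    sub_ne_zero.2 (chi_ne_chi (hC.1 h0C)), fun α => ?_⟩
  rw [← Finset.sum_sub_distrib, Finset.mul_sum,
    Fin.sum_univ_eq_sum_range
      (fun i => (chi M (r 0) - chi N (r 0)) * ((-1) ^ i * α (r i))) (k + 1),
    ← Finset.sum_subset (Finset.subset_univ C), hCdef, Finset.sum_image]
  · refine Finset.sum_congr rfl fun i hi => ?_
    have := hr.chi_sub_chi hM hN (Finset.mem_range.1 hi)
    linear_combination α (r i) * this
  · intro i hi j hj hij
    exact hr.inj i (by simpa using hi) j (by simpa using hj) hij
  · intro i _ hi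
    rw [hCD, Finset.mem_symmDiff] at hi
    by_cases h1 : i ∈ M <;> by_cases h2 : i ∈ N <;> simp_all [chi]

theorem add_le_one_of_meet {x : E → ℝ} (hx : x ∈ edgePolytope e) {i j : E} (hij : Meet e i j)
    (hne : i ≠ j) : x i + x j ≤ 1 := by
  obtain ⟨v, hi, hj⟩ := hij
  rw [← Finset.sum_pair hne]
  refine le_trans (Finset.sum_le_sum_of_subset_of_nonneg ?_ fun i _ _ => hx.1 i) (hx.2.1 v)
  intro a ha
  rcases Finset.mem_insert.1 ha with rfl | ha
  · simpa using hi
  · rw [Finset.mem_singleton.1 ha]; simpa using hj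

theorem le_one_of_mem {x : E → ℝ} (hx : x ∈ edgePolytope e) (i : E) : x i ≤ 1 := by
  have hi : (Quot.out (e i)).1 ∈ e i := Sym2.out_fst_mem (e i)
  refine le_trans ?_ (hx.2.1 (Quot.out (e i)).1)
  exact Finset.single_le_sum (f := x) (fun j _ => hx.1 j) (by simpa using hi)

theorem chi_mem_extremePoints (hl : ∀ i, ¬ (e i).IsDiag) {M : Finset E} (hM : IsMatching e M) :
    chi M ∈ (edgePolytope e).extremePoints ℝ := by
  refine mem_extremePoints.2 ⟨chi_mem_edgePolytope hl hM, fun x hx y hy ⟨a, b, ha, hb, hab, h⟩ => ?_⟩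
  suffices ∀ i, x i = chi M i ∧ y i = chi M i from
    ⟨funext fun i => (this i).1, funext fun i => (this i).2⟩
  intro i
  have hi := congrFun h i
  simp only [Pi.add_apply, Pi.smul_apply, smul_eq_mul] at hi
  have hx0 := hx.1 i
  have hy0 := hy.1 i
  have hx1 := le_one_of_mem hx i
  have hy1 := le_one_of_mem hy i
  by_cases hiM : i ∈ M
  · simp only [chi, hiM, if_true] at hi ⊢
    constructor <;> nlinarith
  · simp only [chi, hiM, if_false] at hi ⊢
    constructor <;> nlinarith

/-- Every alternating chain is the difference of two adjacent vertices of the polytope: the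
inequalities `x (r i) + x (r (i + 1)) ≤ 1`, together with `0 ≤ x a` for the edges `a` off the
chain, define the segment between the two matchings formed by every other edge of the chain. -/
theorem IsAlternatingChain.exists_adjacent (hl : ∀ i, ¬ (e i).IsDiag) {k : ℕ} {r : Fin k → E}
    (h : IsAlternatingChain e r) :
    ∃ u ∈ (edgePolytope e).extremePoints ℝ, ∃ v ∈ (edgePolytope e).extremePoints ℝ, u ≠ v ∧
      IsExposed ℝ (edgePolytope e) (segment ℝ u v) ∧
      ∀ α : E → ℝ, ∑ i, α i * u i - ∑ i, α i * v i = ∑ i : Fin k, (-1) ^ (i : ℕ) * α (r i) := by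
  set M := (Finset.univ.filter fun i : Fin k => ((i : ℕ) : ZMod 2) = 0).image r with hMdef
  set N := (Finset.univ.filter fun i : Fin k => ((i : ℕ) : ZMod 2) = 1).image r with hNdef
  have hM : IsMatching e M := h.isMatching_image 0
  have hN : IsMatching e N := h.isMatching_image 1
  have hMr : ∀ i : Fin k, chi M (r i) = if Even (i : ℕ) then 1 else 0 := by
    intro i
    rw [hMdef, h.chi_image]
    simp only [ZMod.natCast_eq_zero_iff_even]
  have hNr : ∀ i : Fin k, chi N (r i) = if Even (i : ℕ) then 0 else 1 := by
    intro i
    rw [hNdef, h.chi_image]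
    simp only [ZMod.natCast_eq_one_iff_odd, ← Nat.not_even_iff_odd, ite_not]
  have hMoff : ∀ a, a ∉ Finset.univ.image r → chi M a = 0 := fun a => chi_image_of_notMem _
  have hNoff : ∀ a, a ∉ Finset.univ.image r → chi N a = 0 := fun a => chi_image_of_notMem _
  have hMP := chi_mem_edgePolytope hl hM
  have hNP := chi_mem_edgePolytope hl hN
  refine ⟨chi M, chi_mem_extremePoints hl hM, chi N, chi_mem_extremePoints hl hN, ?_, ?_, ?_⟩
  · intro hh
    have := congrFun hh (r ⟨0, h.pos⟩)
    rw [hMr, hNr] at this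
    simp at this
  · intro _
    let A : Finset (Fin k × Fin k) := Finset.univ.filter fun p => (p.2 : ℕ) = p.1 + 1
    let B : Finset E := (Finset.univ.image r)ᶜ
    have hA : ∀ p ∈ A, (p.2 : ℕ) = p.1 + 1 := fun p hp => (Finset.mem_filter.1 hp).2
    have hB : ∀ a ∈ B, a ∉ Finset.univ.image r := fun a => Finset.mem_compl.1
    let coord : E → StrongDual ℝ (E → ℝ) := fun a => ContinuousLinearMap.proj a
    let l : StrongDual ℝ (E → ℝ) :=
      ∑ p ∈ A, (coord (r p.1) + coord (r p.2)) - ∑ a ∈ B, coord a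
    have hlx : ∀ x, l x = A.card -
        (∑ p ∈ A, (1 - (x (r p.1) + x (r p.2))) + ∑ a ∈ B, x a) := by
      intro x
      simp only [l, coord, _root_.sub_apply, _root_.sum_apply,
        _root_.add_apply, ContinuousLinearMap.proj_apply, Finset.sum_sub_distrib]
      simp
      ring
    have hpair : ∀ x ∈ edgePolytope e, ∀ p ∈ A, 0 ≤ 1 - (x (r p.1) + x (r p.2)) := by
      intro x hx p hp
      have hp' := hA p hp
      have := add_le_one_of_meet hx (h.consecutive p.1 p.2 hp')
        (fun hh => by have := h.injective hh; omega)
      linarith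
    -- the points of the segment are those where no inequality has slack
    have hslack : ∀ x ∈ edgePolytope e, l x = A.card → x ∈ segment ℝ (chi M) (chi N) := by
      intro x hx hlA
      rw [hlx] at hlA
      have h1 : 0 ≤ ∑ p ∈ A, (1 - (x (r p.1) + x (r p.2))) := Finset.sum_nonneg (hpair x hx)
      have h2 : 0 ≤ ∑ a ∈ B, x a := Finset.sum_nonneg fun a _ => hx.1 a
      have h3 := (Finset.sum_eq_zero_iff_of_nonneg (hpair x hx)).1 (by linarith)
      have h4 := (Finset.sum_eq_zero_iff_of_nonneg (fun a (_ : a ∈ B) => hx.1 a)).1 (by linarith)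
      set t := x (r ⟨0, h.pos⟩) with ht
      have hxr : ∀ (i : ℕ) (hi : i < k), x (r ⟨i, hi⟩) = if Even i then t else 1 - t := by
        intro i
        induction i with
        | zero => intro hi; simp [ht]
        | succ i ih =>
          intro hi
          have h5 := h3 (⟨i, by omega⟩, ⟨i + 1, hi⟩) (by simp [A])
          rw [ih (by omega)] at h5
          simp only [Nat.even_add_one]
          by_cases hev : Even i
          · simp only [hev, if_true, not_true, if_false] at h5 ⊢; linarith
          · simp only [hev, if_false, not_false_eq_true, if_true] at h5 ⊢; linarith
      refine ⟨t, 1 - t, hx.1 _, by linarith [le_one_of_mem hx (r ⟨0, h.pos⟩)], by ring, ?_⟩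
      funext a
      simp only [Pi.add_apply, Pi.smul_apply, smul_eq_mul]
      by_cases ha : a ∈ Finset.univ.image r
      · obtain ⟨i, -, rfl⟩ := Finset.mem_image.1 ha
        rw [hMr, hNr, hxr i i.2]
        split_ifs <;> ring
      · rw [hMoff a ha, hNoff a ha, h4 a (Finset.mem_compl.2 ha)]
        ring
    have hle : ∀ x ∈ edgePolytope e, l x ≤ A.card := by
      intro x hx
      rw [hlx]
      have h1 : 0 ≤ ∑ p ∈ A, (1 - (x (r p.1) + x (r p.2))) := Finset.sum_nonneg (hpair x hx)
      have h2 : 0 ≤ ∑ a ∈ B, x a := Finset.sum_nonneg fun a _ => hx.1 a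
      linarith
    have hlM : l (chi M) = A.card := by
      rw [hlx, Finset.sum_eq_zero, Finset.sum_eq_zero]
      · ring
      · exact fun a ha => hMoff a (hB a ha)
      · intro p hp
        rw [hMr, hMr, hA p hp]
        by_cases hev : Even (p.1 : ℕ) <;> simp [Nat.even_add_one, hev]
    have hlN : l (chi N) = A.card := by
      rw [hlx, Finset.sum_eq_zero, Finset.sum_eq_zero]
      · ring
      · exact fun a ha => hNoff a (hB a ha)
      · intro p hp
        rw [hNr, hNr, hA p hp]
        by_cases hev : Even (p.1 : ℕ) <;> simp [Nat.even_add_one, hev]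
    refine ⟨l, Set.ext fun x => ⟨fun hx => ?_, fun hx => ?_⟩⟩
    · refine ⟨convex_edgePolytope.segment_subset hMP hNP hx, fun y hy => ?_⟩
      obtain ⟨a, b, -, -, hab, rfl⟩ := hx
      rw [map_add, map_smul, map_smul, hlM, hlN, smul_eq_mul, smul_eq_mul, ← add_mul, hab, one_mul]
      exact hle y hy
    · exact hslack x hx.1 (le_antisymm (hle x hx.1) (hlM ▸ hx.2 _ hMP))
  · intro α
    rw [← Finset.sum_sub_distrib, ← Finset.sum_subset (Finset.subset_univ (Finset.univ.image r)),
      Finset.sum_image (fun i _ j _ hij => h.injective hij)]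
    · refine Finset.sum_congr rfl fun i _ => ?_
      rw [hMr, hNr]
      split_ifs with hev
      · rw [hev.neg_one_pow]; ring
      · rw [(Nat.not_even_iff_odd.1 hev).neg_one_pow]; ring
    · intro a _ ha
      rw [hMoff a ha, hNoff a ha]
      ring

end Edges

section Regions

variable {V : Type*} {G : SimpleGraph V} {n : ℕ}

/-! ### LP-orientations and regions -/

theorem linearFunction_apply (α x : Fin n → ℝ) : linearFunction α x = ∑ i, α i * x i := by
  simp [linearFunction]

theorem not_isDiag_edge (N : G.edgeSet ≃ Fin n) (i : Fin n) : ¬ (N.symm i : Sym2 V).IsDiag :=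
  G.not_isDiag_of_mem_edgeSet (N.symm i).2

/-- Simple paths and even simple cycles are the alternating chains. -/
theorem isAlternatingChain_iff (N : G.edgeSet ≃ Fin n) {k : ℕ} (r : Fin k → G.edgeSet) :
    IsAlternatingChain (fun i => (N.symm i : Sym2 V)) (fun i => N (r i)) ↔
      IsSimplePath r ∨ (IsSimpleCycle r ∧ Even k) := by
  have hmeet : ∀ i j, Meet (fun i => (N.symm i : Sym2 V)) (N (r i)) (N (r j)) ↔
      ShareVertex (r i) (r j) := by
    intro i j; simp [Meet, ShareVertex]
  constructor
  · intro h
    have hchain : IsEdgeChain r :=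
      ⟨h.pos, fun i j hij => h.injective (congrArg N hij),
        fun i j hij => (hmeet i j).1 (h.consecutive i j hij)⟩
    have hsimple : IsSimpleChain r := fun i j hij hs => h.simple i j hij ((hmeet i j).2 hs)
    by_cases hc : IsClosedChain r
    · refine Or.inr ⟨⟨hchain, hc, hsimple⟩, ?_⟩
      have h2 := hc.1
      let i : Fin k := ⟨0, by omega⟩
      let j : Fin k := ⟨k - 1, by omega⟩
      have hj : (j : ℕ) + 1 = k := by simp only [j]; omega
      exact h.even_of_closed i j (by simp only [i, j, Fin.mk_lt_mk]; omega) rfl hj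
        ((hmeet i j).2 (hc.2 i j rfl hj))
    · exact Or.inl ⟨hchain, hc, hsimple⟩
  · intro h
    have hchain : IsEdgeChain r := h.elim (fun h => h.1) fun h => h.1.1
    have hsimple : IsSimpleChain r := h.elim (fun h => h.2.2) fun h => h.1.2.2
    refine ⟨hchain.pos, N.injective.comp hchain.injective,
      fun i j hij => (hmeet i j).2 (hchain.consecutive i j hij),
      fun i j hij hs => hsimple i j hij ((hmeet i j).1 hs), fun i j hij hi hj hs => ?_⟩
    rcases h with h | h
    · refine (h.2.1 ⟨?_, fun i' j' hi' hj' => ?_⟩).elim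
      · have : (i : ℕ) < j := hij
        omega
      · obtain rfl : i' = i := Fin.ext (by omega)
        obtain rfl : j' = j := Fin.ext (by omega)
        exact (hmeet i' j').1 hs
    · exact h.2

/-- A linear function separates all adjacent vertices of the polytope if and only if its
coefficient vector lies on no hyperplane of the arrangement. -/
theorem mem_compl_matchingArrangement_iff [Finite V] (N : G.edgeSet ≃ Fin n) (α : Fin n → ℝ) :
    α ∈ (⋃₀ matchingArrangement G N)ᶜ ↔
      ∀ u v, (polyhedronGraph (matchingPolyhedron G N)).Adj u v →
        linearFunction α u ≠ linearFunction α v := by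
  rw [Set.mem_compl_iff, Set.mem_sUnion]
  constructor
  · rintro h ⟨u, hu⟩ ⟨v, hv⟩ ⟨hne, hface⟩ heq
    obtain ⟨k, r, s, hr, hs, hα⟩ := exists_isAlternatingChain (not_isDiag_edge N) hu hv
      (fun hh => hne (Subtype.ext hh)) hface
    refine h ⟨_, ⟨k, fun i => N.symm (r i), ?_, rfl⟩, ?_⟩
    · exact (isAlternatingChain_iff N _).1 (by simpa using hr)
    · have h1 := hα α
      rw [← linearFunction_apply, ← linearFunction_apply, sub_eq_zero.2 heq] at h1
      simpa [alternatingHyperplane] using (mul_eq_zero.1 h1.symm).resolve_left hs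
  · rintro h ⟨_, ⟨k, r, hr, rfl⟩, hα⟩
    obtain ⟨u, hu, v, hv, hne, hface, hsum⟩ :=
      ((isAlternatingChain_iff N r).2 hr).exists_adjacent (not_isDiag_edge N)
    refine h ⟨u, hu⟩ ⟨v, hv⟩ ⟨fun hh => hne (congrArg Subtype.val hh), hface⟩ ?_
    rw [← sub_eq_zero, linearFunction_apply, linearFunction_apply, hsum α]
    exact hα

theorem continuous_linearFunction (x : Fin n → ℝ) : Continuous fun α => linearFunction α x := by
  simp only [linearFunction_apply]
  fun_prop

theorem linearFunction_combination (a b : ℝ) (α β x : Fin n → ℝ) :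
    linearFunction (a • α + b • β) x = a * linearFunction α x + b * linearFunction β x := by
  simp only [linearFunction_apply, Pi.add_apply, Pi.smul_apply, smul_eq_mul, add_mul, mul_assoc,
    Finset.sum_add_distrib, Finset.mul_sum]

theorem convex_inducingVectors {P : Set (Fin n → ℝ)} (O : GraphOrientation (polyhedronGraph P)) :
    Convex ℝ (inducingVectors O) := by
  have key : ∀ (a b p q p' q' : ℝ), 0 ≤ a → 0 ≤ b → a + b = 1 → p < q → p' < q' →
      a * p + b * p' < a * q + b * q' := by
    intro a b p q p' q' ha hb hab h h'
    rcases ha.eq_or_lt with rfl | ha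
    · obtain rfl : b = 1 := by linarith
      linarith
    · have h1 := mul_lt_mul_of_pos_left h ha
      have h2 := mul_le_mul_of_nonneg_left h'.le hb
      linarith
  intro α hα β hβ a b ha hb hab
  -- on every edge, `α`, `β` and their convex combination order the two ends in the same way
  have hcases : ∀ u v, (polyhedronGraph P).Adj u v →
      (O.dir u v ∧ linearFunction (a • α + b • β) u < linearFunction (a • α + b • β) v) ∨
      (¬ O.dir u v ∧ linearFunction (a • α + b • β) v < linearFunction (a • α + b • β) u) := by
    intro u v huv
    rw [linearFunction_combination, linearFunction_combination]
    by_cases h : O.dir u v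
    · exact Or.inl ⟨h, key _ _ _ _ _ _ ha hb hab ((hα.2 u v huv).1 h) ((hβ.2 u v huv).1 h)⟩
    · have h1 : ¬ linearFunction α u < linearFunction α v := fun h' => h ((hα.2 u v huv).2 h')
      have h2 : ¬ linearFunction β u < linearFunction β v := fun h' => h ((hβ.2 u v huv).2 h')
      exact Or.inr ⟨h, key _ _ _ _ _ _ ha hb hab
        (lt_of_le_of_ne (not_lt.1 h1) (hα.1 u v huv).symm)
        (lt_of_le_of_ne (not_lt.1 h2) (hβ.1 u v huv).symm)⟩
  refine ⟨fun u v huv => ?_, fun u v huv => ?_⟩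
  · rcases hcases u v huv with h | h
    · exact h.2.ne
    · exact h.2.ne'
  · rcases hcases u v huv with h | h
    · simp [h.1, h.2]
    · simp [h.1, h.2.le]

theorem exists_inducingVector {P : Set (Fin n → ℝ)} {O : GraphOrientation (polyhedronGraph P)}
    (hO : O ∈ lpOrientations P) : ∃ α, α ∈ inducingVectors O := by
  obtain ⟨φ, hφ⟩ := hO
  refine ⟨fun i => φ (Pi.single i 1), ?_⟩
  have : linearFunction (fun i => φ (Pi.single i 1)) = φ := by
    refine LinearMap.pi_ext' fun i => LinearMap.ext_ring ?_
    simp [linearFunction_apply, Pi.single_apply]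
  simpa [inducingVectors, this] using hφ

theorem eq_of_mem_inducingVectors {P : Set (Fin n → ℝ)}
    {O O' : GraphOrientation (polyhedronGraph P)} {α : Fin n → ℝ} (h : α ∈ inducingVectors O)
    (h' : α ∈ inducingVectors O') : O = O' := by
  ext u v
  exact ⟨fun hd => (h'.2 u v (O.adj_of_dir u v hd)).2 ((h.2 u v (O.adj_of_dir u v hd)).1 hd),
    fun hd => (h.2 u v (O'.adj_of_dir u v hd)).2 ((h'.2 u v (O'.adj_of_dir u v hd)).1 hd)⟩

/-- The orientation induced by a linear function that separates adjacent vertices. -/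
def inducedOrientation {P : Set (Fin n → ℝ)} (φ : (Fin n → ℝ) →ₗ[ℝ] ℝ)
    (h : ∀ u v, (polyhedronGraph P).Adj u v → φ u ≠ φ v) :
    GraphOrientation (polyhedronGraph P) where
  dir u v := (polyhedronGraph P).Adj u v ∧ φ u < φ v
  adj_of_dir _ _ hd := hd.1
  xor_dir u v huv := by
    rcases lt_or_gt_of_ne (h u v huv) with hlt | hlt
    · exact Or.inl ⟨⟨huv, hlt⟩, fun h' => lt_asymm hlt h'.2⟩
    · exact Or.inr ⟨⟨huv.symm, hlt⟩, fun h' => lt_asymm hlt h'.2⟩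

theorem induces_inducedOrientation {P : Set (Fin n → ℝ)} (φ : (Fin n → ℝ) →ₗ[ℝ] ℝ)
    (h : ∀ u v, (polyhedronGraph P).Adj u v → φ u ≠ φ v) :
    Induces φ (inducedOrientation φ h) :=
  ⟨h, fun _ _ huv => ⟨fun hd => hd.2, fun hlt => ⟨huv, hlt⟩⟩⟩

/-- `F(O)` is convex, hence contained in one region; and inside a region no linear function can
change the order of two adjacent vertices, by the intermediate value theorem. -/
theorem inducingVectors_eq_connectedComponentIn [Finite V] {N : G.edgeSet ≃ Fin n}
    {O : GraphOrientation (polyhedronGraph (matchingPolyhedron G N))} {α : Fin n → ℝ}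
    (hα : α ∈ inducingVectors O) :
    inducingVectors O = connectedComponentIn (⋃₀ matchingArrangement G N)ᶜ α := by
  refine Set.Subset.antisymm ?_ fun β hβ => ?_
  · exact (convex_inducingVectors O).isPreconnected.subset_connectedComponentIn hα
      fun β hβ => (mem_compl_matchingArrangement_iff N β).2 hβ.1
  · have hsep : ∀ γ ∈ connectedComponentIn (⋃₀ matchingArrangement G N)ᶜ α, ∀ u v,
        (polyhedronGraph (matchingPolyhedron G N)).Adj u v →
          linearFunction γ u ≠ linearFunction γ v := fun γ hγ =>
      (mem_compl_matchingArrangement_iff N γ).1 (connectedComponentIn_subset _ _ hγ)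
    have hα' := mem_connectedComponentIn ((mem_compl_matchingArrangement_iff N α).2 hα.1)
    have hsame : ∀ γ ∈ connectedComponentIn (⋃₀ matchingArrangement G N)ᶜ α,
        ∀ δ ∈ connectedComponentIn (⋃₀ matchingArrangement G N)ᶜ α, ∀ u v,
        (polyhedronGraph (matchingPolyhedron G N)).Adj u v →
          linearFunction γ u < linearFunction γ v → linearFunction δ u < linearFunction δ v := by
      intro γ hγ δ hδ u v huv hlt
      by_contra hge
      obtain ⟨ε, hε, heq⟩ := isPreconnected_connectedComponentIn.intermediate_value₂ hγ hδ
        (continuous_linearFunction u.1).continuousOn (continuous_linearFunction v.1).continuousOn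
        hlt.le (not_lt.1 hge)
      exact hsep ε hε u v huv heq
    exact ⟨hsep β hβ, fun u v huv => (hα.2 u v huv).trans
      ⟨hsame α hα' β hβ u v huv, hsame β hβ α hα' u v huv⟩⟩

end Regions

end MatchingArrangement

theorem mainTheorem1 {V : Type*} [Finite V] (G : SimpleGraph V) {n : ℕ}
    (N : G.edgeSet ≃ Fin n) :
    (∀ O ∈ MatchingArrangement.lpOrientations (MatchingArrangement.matchingPolyhedron G N),
      MatchingArrangement.inducingVectors O ∈
        MatchingArrangement.regions (MatchingArrangement.matchingArrangement G N)) ∧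
    Set.BijOn
      (fun O : MatchingArrangement.GraphOrientation (MatchingArrangement.polyhedronGraph
        (MatchingArrangement.matchingPolyhedron G N)) => MatchingArrangement.inducingVectors O)
      (MatchingArrangement.lpOrientations (MatchingArrangement.matchingPolyhedron G N))
      (MatchingArrangement.regions (MatchingArrangement.matchingArrangement G N)) := by
  open MatchingArrangement in
  have hregion : ∀ O ∈ lpOrientations (matchingPolyhedron G N),
      inducingVectors O ∈ regions (matchingArrangement G N) := by
    intro O hO
    obtain ⟨α, hα⟩ := exists_inducingVector hO
    exact ⟨α, (mem_compl_matchingArrangement_iff N α).2 hα.1,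
      inducingVectors_eq_connectedComponentIn hα⟩
  refine ⟨hregion, hregion, ?_, ?_⟩
  · intro O hO O' _ heq
    replace heq : MatchingArrangement.inducingVectors O =
      MatchingArrangement.inducingVectors O' := heq
    obtain ⟨α, hα⟩ := MatchingArrangement.exists_inducingVector hO
    exact MatchingArrangement.eq_of_mem_inducingVectors hα (heq ▸ hα)
  · rintro _ ⟨α, hα, rfl⟩
    have hsep := (MatchingArrangement.mem_compl_matchingArrangement_iff N α).1 hα
    have hind := MatchingArrangement.induces_inducedOrientation
      (MatchingArrangement.linearFunction α) hsep
    exact ⟨_, ⟨_, hind⟩, MatchingArrangement.inducingVectors_eq_connectedComponentIn hind⟩
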